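/- **Conventions.** All $C^*$-algebras are unital; a UCP map is a unital completely positive (CP) linear map. An operator system in a $C^*$-algebra $A$ is a (not necessarily closed) self-adjoint linear subspace $S\subseteq A$ containing the unit of $A$, and $A=C^*(S)$ means that $A$ is the closed $*$-algebra generated by $S$. A representation of $A$ is a $*$-homomorphism $\pi:A\to B(H)$ with $H$ a complex Hilbert space; it is non-degenerate if $\pi(A)H$ spans a dense subspace of $H$. For a UCP map $\eta:A\to A$, we say that $S$ is *hyperrigid with respect to $\eta$* in $A$ if for every faithful representation $\sigma:A\to B(H)$ on a Hilbert space $H$ and every sequence of UCP maps $\psi_n:B(H)\to B(H)$, $n=1,2,\dots$, $$\lim_{n\to\infty}\|\psi_n(\sigma(s))-\sigma(\eta(s))\|=0\ \ \forall s\in S\ \Longrightarrow\ \lim_{n\to\infty}\|\psi_n(\sigma(a))-\sigma(\eta(a))\|=0\ \ \forall a\in A .$$ **Theorem.** Let $A$ be a $C^*$-algebra, let $S\subseteq A$ be a separable operator system with $A=C^*(S)$, and let $\eta:A\to A$ be a UCP map. The following statements are equivalent. 1. $S$ is hyperrigid with respect to $\eta$ in $A$. 2. For every non-degenerate representation $\pi:A\to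 B(H)$ on a separable Hilbert space $H$ and every sequence of UCP maps $\phi_n:A\to B(H)$, if $\lim_{n\to\infty}\|\phi_n(s)-\pi(\eta(s))\|=0$ for all $s\in S$, then $\lim_{n\to\infty}\|\phi_n(a)-\pi(\eta(a))\|=0$ for all $a\in A$. 3. For every non-degenerate representation $\pi:A\to B(H)$ on a separable Hilbert space $H$, the map $\pi\circ\eta|_S$ has a unique CP extension to $A$, namely $\pi\circ\eta$ itself. 4. For every $C^*$-algebra $B$, every unital $*$-homomorphism $\rho:A\to B$ and every UCP map $\phi:B\to B$, if $\phi(\rho(s))=\rho(\eta(s))$ for all $s\in S$, then $\phi(\rho(a))=\rho(\eta(a))$ for all $a\in A$. -/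

import Mathlib

open Filter Topology TopologicalSpace
open scoped CStarAlgebra

universe u

/-- A subspace `S` of a unital C⋆-algebra is an *operator system* if it contains the unit and is
self-adjoint (it is not required to be closed). -/
def IsOperatorSystem {A : Type u} [CStarAlgebra A] (S : Submodule ℂ A) : Prop :=
  (1 : A) ∈ S ∧ ∀ a ∈ S, star a ∈ S

/-- `S` generates `A` as a C⋆-algebra: the norm closure of the ⋆-algebra generated by `S` is all
of `A`, that is `C⋆(S) = A`. -/
def GeneratesCStarAlgebra {A : Type u} [CStarAlgebra A] (S : Submodule ℂ A) : Prop :=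
  (StarAlgebra.adjoin ℂ (S : Set A)).topologicalClosure = ⊤

/-- A representation `π : A → B(H)` (a ⋆-homomorphism, not assumed to be unital) is
*non-degenerate* if the vectors `π(a) h` span a dense subspace of `H`. -/
def IsNondegenerateRep {A H : Type u} [CStarAlgebra A] [NormedAddCommGroup H]
    [InnerProductSpace ℂ H] [CompleteSpace H] (π : A →⋆ₙₐ[ℂ] (H →L[ℂ] H)) : Prop :=
  (Submodule.span ℂ {x : H | ∃ (a : A) (h : H), π a h = x}).topologicalClosure = ⊤

/-- `S` is *hyperrigid with respect to* the map `η : A → A`: for every faithful representation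
`σ : A → B(H)` on a Hilbert space and every sequence of unital completely positive maps
`ψ n : B(H) → B(H)`, if `‖ψ n (σ s) - σ (η s)‖ → 0` for all `s ∈ S`, then
`‖ψ n (σ a) - σ (η a)‖ → 0` for all `a ∈ A`. -/
def IsHyperrigidWrt {A : Type u} [CStarAlgebra A] [PartialOrder A] [StarOrderedRing A]
    (S : Submodule ℂ A) (η : A →CP A) : Prop :=
  ∀ (H : Type u) [NormedAddCommGroup H] [InnerProductSpace ℂ H] [CompleteSpace H]
    (σ : A →⋆ₙₐ[ℂ] (H →L[ℂ] H)), Function.Injective σ →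
    ∀ ψ : ℕ → ((H →L[ℂ] H) →CP (H →L[ℂ] H)), (∀ n, ψ n 1 = 1) →
      (∀ s ∈ S, Tendsto (fun n => ‖ψ n (σ s) - σ (η s)‖) atTop (𝓝 0)) →
      ∀ a : A, Tendsto (fun n => ‖ψ n (σ a) - σ (η a)‖) atTop (𝓝 0)

/-- The restriction of `f : A → B` to `S` has a unique completely positive extension to `A`,
namely `f` itself: `f` is completely positive, and every completely positive map on `A` that
agrees with `f` on `S` is equal to `f`. -/
def IsUniqueCPExtensionOfRestriction {A B : Type u}
    [CStarAlgebra A] [PartialOrder A] [StarOrderedRing A]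
    [CStarAlgebra B] [PartialOrder B] [StarOrderedRing B]
    (S : Submodule ℂ A) (f : A → B) : Prop :=
  (∃ Φ : A →CP B, ∀ a, Φ a = f a) ∧
    ∀ Ψ : A →CP B, (∀ s ∈ S, Ψ s = f s) → ∀ a, Ψ a = f a

/-! ### Positive operator matrices and their quadratic forms. -/

section MatrixPositivity

open scoped ComplexOrder InnerProductSpace

/-! Everything is compared with unique extension on separable spaces (`UniqueExtensionWrt`).

From unique extension to convergence (`UniqueExtensionWrt.tendsto`): let `Φ n` be CP maps into any
C⋆-algebra `D` that converge to `ρ ∘ η` on `S`. If convergence fails at a self-adjoint element,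
positive functionals of norm at most one detect the failure, and their limit along an ultrafilter is
a positive functional `F` on the bounded sequences in `D`. The GNS space of `F ∘ ρ` is separable
because `A` is, although `D` need not be. Compressing the sequence `(Φ n)` to that space gives a CP
map which agrees with `π ∘ η` on `S`, `π` being the GNS representation, hence everywhere; evaluation
at the cyclic vector is a contradiction. This controls the corner cut out by `p = ρ 1`; the other
corners vanish by a Cauchy-Schwarz estimate, since `Φ n 1` tends to `p`.

Back to unique extension (`ExtensionPair.exists_faithful`): given a CP map `Ψ` equal to `π ∘ η` on
`S`, dilate `Ψ` by Stinespring to a representation `π₁`, dilate `π₁ ∘ η` to `π₂`, and so on. On the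
direct sum `σ` of the chain, the Stinespring isometries form one shift `W`, and `ψ = W⋆ · W` is a
UCP map of the whole `B(K)` with `ψ ∘ σ = Ψ ⊕ π₁ ∘ η ⊕ π₂ ∘ η ⊕ ⋯`. It agrees with `σ ∘ η` on `S`,
and it does so on `A` only if `Ψ = π ∘ η`. Chains started at all GNS representations make `σ`
faithful. -/

theorem CStarAlgebra.exists_eq_star_mul_self_of_nonneg {E : Type*} [NonUnitalCStarAlgebra E]
    [PartialOrder E] [StarOrderedRing E] {x : E} (hx : 0 ≤ x) : ∃ y : E, x = star y * y :=
  CStarAlgebra.nonneg_iff_eq_star_mul_self.1 hx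

theorem Finset.sum_sum_sum_sum_comm {n M : Type*} [Fintype n] [AddCommMonoid M]
    (f : n → n → n → n → M) :
    ∑ i, ∑ j, ∑ k, ∑ l, f i j k l = ∑ k, ∑ l, ∑ i, ∑ j, f i j k l := by
  have h : ∀ i, ∑ j, ∑ k, ∑ l, f i j k l = ∑ k, ∑ l, ∑ j, f i j k l := fun i => by
    rw [Finset.sum_comm]
    exact Finset.sum_congr rfl fun k _ => Finset.sum_comm
  simp only [h]
  rw [Finset.sum_comm]
  exact Finset.sum_congr rfl fun k _ => Finset.sum_comm

/-- The decomposition of a self-adjoint element into positive and negative part. -/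
theorem CStarAlgebra.exists_negPart {E : Type*} [NonUnitalCStarAlgebra E]
    [PartialOrder E] [StarOrderedRing E] {x : E} (hx : IsSelfAdjoint x) :
    ∃ p q : E, 0 ≤ p ∧ 0 ≤ q ∧ x = p - q ∧ x * q = -(q * q) := by
  refine ⟨x⁺, x⁻, CFC.posPart_nonneg x, CFC.negPart_nonneg x,
    (CFC.posPart_sub_negPart x hx).symm, ?_⟩
  nth_rw 1 [← CFC.posPart_sub_negPart x hx]
  rw [sub_mul, CFC.posPart_mul_negPart, zero_sub]

variable {D : Type*} [CStarAlgebra D] [PartialOrder D] [StarOrderedRing D]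
variable {H : Type*} [NormedAddCommGroup H] [InnerProductSpace ℂ H] [CompleteSpace H]
variable {n : Type*} [Fintype n]

/-- A positive matrix over a C⋆-algebra has positive quadratic form. -/
theorem CStarMatrix.sum_star_mul_mul_nonneg {N : CStarMatrix n n D} (hN : 0 ≤ N) (y : n → D) :
    0 ≤ ∑ i, ∑ j, star (y i) * N i j * y j := by
  obtain ⟨L, rfl⟩ := CStarAlgebra.exists_eq_star_mul_self_of_nonneg hN
  have : ∑ i, ∑ j, star (y i) * (star L * L) i j * y j
      = ∑ l, star (∑ j, L l j * y j) * ∑ j, L l j * y j := by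
    have h : ∀ l, star (∑ j, L l j * y j) * ∑ j, L l j * y j
        = ∑ i, ∑ j, star (y i) * (star (L l i) * L l j) * y j := fun l => by
      rw [star_sum, Finset.sum_mul_sum]
      simp only [star_mul, mul_assoc]
    simp only [h]
    conv_rhs => rw [Finset.sum_comm]
    refine Finset.sum_congr rfl fun i _ => ?_
    conv_rhs => rw [Finset.sum_comm]
    refine Finset.sum_congr rfl fun j _ => ?_
    simp only [CStarMatrix.mul_apply, CStarMatrix.star_apply, Finset.mul_sum, Finset.sum_mul]
  rw [this]
  exact Finset.sum_nonneg fun l _ => star_mul_self_nonneg _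

theorem CStarMatrix.sum_inner_eq (L : CStarMatrix n n (H →L[ℂ] H)) (x : n → H) :
    ∑ i, ∑ j, ⟪x i, (star L * L) i j (x j)⟫_ℂ
      = ∑ l, ((‖∑ j, L l j (x j)‖ ^ 2 : ℝ) : ℂ) := by
  have h : ∀ l, ((‖∑ j, L l j (x j)‖ ^ 2 : ℝ) : ℂ)
      = ∑ i, ∑ j, ⟪L l i (x i), L l j (x j)⟫_ℂ := by
    intro l
    have := inner_self_eq_norm_sq_to_K (𝕜 := ℂ) (∑ j, L l j (x j))
    rw [sum_inner] at this
    simp only [inner_sum] at this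
    rw [this]; norm_cast
  have h2 : ∀ i j, ⟪x i, (star L * L) i j (x j)⟫_ℂ = ∑ l, ⟪L l i (x i), L l j (x j)⟫_ℂ := by
    intro i j
    rw [CStarMatrix.mul_apply, sum_apply, inner_sum]
    refine Finset.sum_congr rfl fun l _ => ?_
    rw [CStarMatrix.star_apply, ContinuousLinearMap.star_eq_adjoint,
      mul_apply_eq_comp, ContinuousLinearMap.adjoint_inner_right]
  simp only [h, h2]
  conv_rhs => rw [Finset.sum_comm]
  refine Finset.sum_congr rfl fun i _ => ?_
  rw [Finset.sum_comm]

theorem CStarMatrix.sum_inner_nonneg {N : CStarMatrix n n (H →L[ℂ] H)} (hN : 0 ≤ N) (x : n → H) :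
    0 ≤ ∑ i, ∑ j, ⟪x i, N i j (x j)⟫_ℂ := by
  obtain ⟨L, rfl⟩ := CStarAlgebra.exists_eq_star_mul_self_of_nonneg hN
  rw [CStarMatrix.sum_inner_eq]
  exact Finset.sum_nonneg fun l _ => Complex.zero_le_real.2 (sq_nonneg _)

theorem CStarMatrix.eq_zero_of_sum_inner_nonpos {L : CStarMatrix n n (H →L[ℂ] H)}
    (h : ∀ x : n → H, ∑ i, ∑ j, ⟪x i, (star L * L) i j (x j)⟫_ℂ ≤ 0) : L = 0 := by
  classical
  ext l i v
  have key := h (Pi.single i v)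
  rw [CStarMatrix.sum_inner_eq, ← Complex.ofReal_sum, ← Complex.ofReal_zero,
    Complex.real_le_real] at key
  have h0 := (Finset.sum_eq_zero_iff_of_nonneg fun l _ => sq_nonneg _).1
    (le_antisymm key (Finset.sum_nonneg fun l _ => sq_nonneg _)) l (Finset.mem_univ l)
  have h1 : ∑ j, L l j (Pi.single (M := fun _ => H) i v j) = L l i v := by
    rw [Finset.sum_eq_single i]
    · simp
    · intro j _ hj
      rw [Pi.single_eq_of_ne hj, map_zero]
    · simp
  rw [h1] at h0
  simpa using h0

/-- Testing the form on vectors `Q x`, with `Q` the negative part of `N`, gives the form of `Q * N *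
Q = -Q³`, which is both nonnegative and nonpositive; this forces `Q = 0`. -/
theorem CStarMatrix.nonneg_of_sum_inner_nonneg {N : CStarMatrix n n (H →L[ℂ] H)}
    (hN : IsSelfAdjoint N) (h : ∀ x : n → H, 0 ≤ ∑ i, ∑ j, ⟪x i, N i j (x j)⟫_ℂ) : 0 ≤ N := by
  obtain ⟨P, Q, hP, hQ, hPQ, hNQ⟩ := CStarAlgebra.exists_negPart hN
  obtain ⟨R, hR⟩ := CStarAlgebra.exists_eq_star_mul_self_of_nonneg hQ
  have hQs : star Q = Q := (IsSelfAdjoint.of_nonneg hQ).star_eq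
  have hQNQ : star (R * Q) * (R * Q) = - (Q * N * Q) := by
    rw [mul_assoc Q, hNQ, star_mul, hQs, mul_assoc Q, ← mul_assoc (star R), ← hR, mul_neg, neg_neg]
  have hRQ : R * Q = 0 := by
    refine CStarMatrix.eq_zero_of_sum_inner_nonpos fun x => ?_
    have h1 := h fun i => ∑ j, Q i j (x j)
    have h2 : ∑ i, ∑ j, ⟪∑ k, Q i k (x k), N i j (∑ k, Q j k (x k))⟫_ℂ
        = ∑ i, ∑ j, ⟪x i, (Q * N * Q) i j (x j)⟫_ℂ := by
      have e1 : ∀ i j, ⟪∑ k, Q i k (x k), N i j (∑ l, Q j l (x l))⟫_ℂ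
          = ∑ k, ∑ l, ⟪x k, Q k i (N i j (Q j l (x l)))⟫_ℂ := by
        intro i j
        rw [sum_inner]
        refine Finset.sum_congr rfl fun k _ => ?_
        rw [map_sum, inner_sum]
        refine Finset.sum_congr rfl fun l _ => ?_
        rw [← CStarMatrix.star_apply_of_isSelfAdjoint (IsSelfAdjoint.of_nonneg hQ),
          ContinuousLinearMap.star_eq_adjoint, ContinuousLinearMap.adjoint_inner_left]
      have e2 : ∀ k l, ⟪x k, (Q * N * Q) k l (x l)⟫_ℂ
          = ∑ i, ∑ j, ⟪x k, Q k i (N i j (Q j l (x l)))⟫_ℂ := by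
        intro k l
        rw [CStarMatrix.mul_apply]
        simp only [CStarMatrix.mul_apply, Finset.sum_mul, sum_apply, inner_sum]
        rw [Finset.sum_comm]
        rfl
      simp only [e1, e2]
      exact Finset.sum_sum_sum_sum_comm _
    rw [h2] at h1
    rw [hQNQ]
    simpa using h1
  have hQQ : Q * Q = 0 := by
    nth_rw 1 [hR]
    rw [mul_assoc, hRQ, mul_zero]
  have : Q = 0 := by
    rw [← CStarRing.star_mul_self_eq_zero_iff, hQs, hQQ]
  rw [hPQ, this, sub_zero]
  exact hP

end MatrixPositivity
-- Positive functionals that separate the positive cone.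
section Functionals
variable {D : Type*} [CStarAlgebra D] [PartialOrder D] [StarOrderedRing D]

open scoped ComplexOrder ComplexStarModule

/-- The complex-linear extension of a real-linear functional from the self-adjoint part. -/
noncomputable def complexifyFunctional (g : D →ₗ[ℝ] ℝ) : D →ₗ[ℂ] ℂ where
  toFun x := (g (ℜ x) : ℂ) + g (ℑ x) * Complex.I
  map_add' x y := by
    simp only [map_add, AddSubgroup.coe_add, Complex.ofReal_add]; ring
  map_smul' z x := by
    apply Complex.ext <;>
    simp [realPart_smul, imaginaryPart_smul]

/-- Hahn-Banach for the closed positive cone over the reals; the separating functional is then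
complexified. -/
theorem exists_positiveLinearMap_re_neg {d : D} (hd : IsSelfAdjoint d) (hd0 : ¬ 0 ≤ d) :
    ∃ f : D →ₚ[ℂ] ℂ, (f d).re < 0 := by
  obtain ⟨g, hg, hgd⟩ := (ProperCone.positive ℝ D).hyperplane_separation_point (x₀ := d) hd0
  refine ⟨PositiveLinearMap.mk₀ (complexifyFunctional (g : D →ₗ[ℝ] ℝ)) fun x hx => ?_, ?_⟩
  · simpa [complexifyFunctional, (IsSelfAdjoint.of_nonneg hx).coe_realPart, (IsSelfAdjoint.of_nonneg hx).imaginaryPart] using hg x hx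
  · change (complexifyFunctional (g : D →ₗ[ℝ] ℝ) d).re < 0
    simpa [complexifyFunctional, hd.coe_realPart] using hgd

end Functionals

/-! ### Separability of the generated algebra. -/

section Separability

theorem TopologicalSpace.IsSeparable.setMul {A : Type*} [TopologicalSpace A] [Mul A] [ContinuousMul A] {s t : Set A}
    (hs : IsSeparable s) (ht : IsSeparable t) : IsSeparable (Set.image2 (· * ·) s t) := by
  rw [← Set.image_uncurry_prod]
  exact (hs.prod ht).image continuous_mul

theorem TopologicalSpace.IsSeparable.submonoidClosure {A : Type*} [TopologicalSpace A] [Monoid A] [ContinuousMul A]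
    {s : Set A} (hs : IsSeparable s) : IsSeparable (Submonoid.closure s : Set A) := by
  -- `P n` is the set of products of `n` factors from `s`.
  let P : ℕ → Set A := fun n => Nat.rec {1} (fun _ t => Set.image2 (· * ·) t s) n
  have hP : ∀ n, IsSeparable (P n) := fun n => by
    induction n with
    | zero => exact (Set.countable_singleton 1).isSeparable
    | succ n ih => exact ih.setMul hs
  refine (IsSeparable.iUnion hP).mono fun x hx => ?_
  induction hx using Submonoid.closure_induction_right with
  | one => exact Set.mem_iUnion.2 ⟨0, rfl⟩
  | mul_right x _ y hy ih =>
    obtain ⟨n, hn⟩ := Set.mem_iUnion.1 ih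
    exact Set.mem_iUnion.2 ⟨n + 1, x, hn, y, hy, rfl⟩

theorem separableSpace_of_generates {A : Type u} [CStarAlgebra A] {S : Submodule ℂ A}
    (hS : IsOperatorSystem S) (hsep : IsSeparable (S : Set A)) (hgen : GeneratesCStarAlgebra S) :
    SeparableSpace A := by
  have hst : star (S : Set A) = S := by
    ext a
    exact ⟨fun h => star_star a ▸ hS.2 _ h, fun h => hS.2 _ h⟩
  have h1 : IsSeparable (StarAlgebra.adjoin ℂ (S : Set A) : Set A) := by
    have : (StarAlgebra.adjoin ℂ (S : Set A) : Set A)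
        = (Submodule.span ℂ (Submonoid.closure (S : Set A) : Set A) : Set A) := by
      rw [← Algebra.adjoin_eq_span]
      change ((StarAlgebra.adjoin ℂ (S : Set A)).toSubalgebra : Set A) = _
      rw [StarAlgebra.adjoin_toSubalgebra, hst, Set.union_self]
      rfl
    rw [this]
    exact hsep.submonoidClosure.span
  have h2 := h1.closure
  rw [← StarSubalgebra.topologicalClosure_coe, hgen] at h2
  exact isSeparable_univ_iff.1 h2

end Separability

/-! ### GNS spaces and compression of maps to them. -/

section GNS

open scoped ComplexOrder InnerProductSpace
open UniformSpace

namespace PositiveLinearMap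

variable {A D : Type*} [CStarAlgebra A] [PartialOrder A] [StarOrderedRing A]
  [CStarAlgebra D] [PartialOrder D] [StarOrderedRing D]

theorem continuous_toPreGNS (g : A →ₚ[ℂ] ℂ) : Continuous g.toPreGNS := by
  obtain ⟨C, hC⟩ := g.exists_norm_apply_le
  refine AddMonoidHomClass.continuous_of_bound g.toPreGNS.toLinearMap (NNReal.sqrt C) fun a => ?_
  refine le_of_sq_le_sq ?_ (by positivity)
  have h := g.preGNS_norm_sq (g.toPreGNS a)
  rw [ofPreGNS_toPreGNS] at h
  have h2 := hC (star a * a)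
  rw [← h, CStarRing.norm_star_mul_self] at h2
  rw [mul_pow, Real.coe_sqrt, Real.sq_sqrt C.coe_nonneg, sq ‖a‖]
  simpa using h2

instance separableSpace_GNS [SeparableSpace A] (g : A →ₚ[ℂ] ℂ) : SeparableSpace g.GNS := by
  have : SeparableSpace g.PreGNS :=
    g.toPreGNS.surjective.denseRange.separableSpace g.continuous_toPreGNS
  infer_instance

/-- The pullback of a positive functional under a ⋆-homomorphism. -/
noncomputable def pullback (F : D →ₚ[ℂ] ℂ) (ρ : A →⋆ₙₐ[ℂ] D) : A →ₚ[ℂ] ℂ :=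
  PositiveLinearMap.mk₀ (F.toLinearMap ∘ₗ (ρ : A →ₗ[ℂ] D)) fun a ha => by
    obtain ⟨b, rfl⟩ := CStarAlgebra.exists_eq_star_mul_self_of_nonneg ha
    change 0 ≤ F (ρ (star b * b))
    rw [map_mul, map_star]
    exact F.map_nonneg (star_mul_self_nonneg (ρ b))

theorem pullback_apply (F : D →ₚ[ℂ] ℂ) (ρ : A →⋆ₙₐ[ℂ] D) (a : A) : F.pullback ρ a = F (ρ a) := rfl

/-- The map of GNS spaces induced by a ⋆-homomorphism. -/
noncomputable def gnsMap (F : D →ₚ[ℂ] ℂ) (ρ : A →⋆ₙₐ[ℂ] D) : (F.pullback ρ).GNS →L[ℂ] F.GNS :=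
  (LinearMap.mkContinuous (F.toPreGNS.toLinearMap ∘ₗ (ρ : A →ₗ[ℂ] D) ∘ₗ
    (F.pullback ρ).ofPreGNS.toLinearMap) 1 fun x => by
      rw [one_mul, preGNS_norm_def, preGNS_norm_def, pullback_apply, map_mul ρ, map_star ρ]
      rfl).completion

theorem gnsMap_coe (F : D →ₚ[ℂ] ℂ) (ρ : A →⋆ₙₐ[ℂ] D) (a : A) :
    F.gnsMap ρ ((F.pullback ρ).toPreGNS a : (F.pullback ρ).GNS)
      = (F.toPreGNS (ρ a) : F.GNS) := by
  simp [gnsMap]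

theorem inner_gnsStarAlgHom (g : A →ₚ[ℂ] ℂ) (a b c : A) :
    ⟪(g.toPreGNS b : g.GNS), g.gnsStarAlgHom a (g.toPreGNS c : g.GNS)⟫_ℂ = g (star b * (a * c)) := by
  simp [preGNS_inner_def]

/-- The compression to the GNS space of `F ∘ ρ` of a linear map `A → D`. -/
noncomputable def gnsCompress (F : D →ₚ[ℂ] ℂ) (ρ : A →⋆ₙₐ[ℂ] D) (Φ : A →ₗ[ℂ] D) :
    A →ₗ[ℂ] ((F.pullback ρ).GNS →L[ℂ] (F.pullback ρ).GNS) where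
  toFun a := (F.gnsMap ρ).adjoint ∘L F.gnsStarAlgHom (Φ a) ∘L F.gnsMap ρ
  map_add' a b := by ext; simp
  map_smul' z a := by ext; simp

/-- Matrix coefficients on the dense subspace: every question about the compression becomes one
about `F`. -/
theorem inner_gnsCompress (F : D →ₚ[ℂ] ℂ) (ρ : A →⋆ₙₐ[ℂ] D) (Φ : A →ₗ[ℂ] D) (a b c : A) :
    ⟪((F.pullback ρ).toPreGNS b : (F.pullback ρ).GNS),
      F.gnsCompress ρ Φ a ((F.pullback ρ).toPreGNS c : (F.pullback ρ).GNS)⟫_ℂ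
      = F (star (ρ b) * Φ a * ρ c) := by
  change ⟪_, (F.gnsMap ρ).adjoint (F.gnsStarAlgHom (Φ a) (F.gnsMap ρ _))⟫_ℂ = _
  rw [ContinuousLinearMap.adjoint_inner_right, gnsMap_coe, gnsMap_coe, inner_gnsStarAlgHom,
    mul_assoc]

theorem gns_ext {g : A →ₚ[ℂ] ℂ} {T T' : g.GNS →L[ℂ] g.GNS}
    (h : ∀ b c : A, ⟪(g.toPreGNS b : g.GNS), T (g.toPreGNS c : g.GNS)⟫_ℂ
      = ⟪(g.toPreGNS b : g.GNS), T' (g.toPreGNS c : g.GNS)⟫_ℂ) : T = T' := by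
  ext x
  refine ext_inner_left ℂ fun y => ?_
  induction x, y using Completion.induction_on₂ with
  | hp => apply isClosed_eq <;> fun_prop
  | ih x y => exact h (g.ofPreGNS y) (g.ofPreGNS x)

theorem gnsCompress_star (F : D →ₚ[ℂ] ℂ) (ρ : A →⋆ₙₐ[ℂ] D) (Φ : A →ₗ[ℂ] D)
    (hΦ : ∀ a, Φ (star a) = star (Φ a)) (a : A) :
    F.gnsCompress ρ Φ (star a) = star (F.gnsCompress ρ Φ a) := by
  refine gns_ext fun b c => ?_
  rw [ContinuousLinearMap.star_eq_adjoint, ContinuousLinearMap.adjoint_inner_right,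
    ← inner_conj_symm (F.gnsCompress ρ Φ a _), inner_gnsCompress, inner_gnsCompress, hΦ,
    ← Complex.star_def, ← map_star F]
  simp only [star_mul, star_star, mul_assoc]

/-- The compression is completely positive if `Φ` is so weakly on `F` and the range of `ρ`. -/
noncomputable def gnsCompressCP (F : D →ₚ[ℂ] ℂ) (ρ : A →⋆ₙₐ[ℂ] D) (Φ : A →ₗ[ℂ] D)
    (hstar : ∀ a, Φ (star a) = star (Φ a))
    (hpos : ∀ (k : ℕ) (M : CStarMatrix (Fin k) (Fin k) A), 0 ≤ M → ∀ b : Fin k → A,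
      0 ≤ F (∑ i, ∑ j, star (ρ (b i)) * Φ (M i j) * ρ (b j))) :
    A →CP ((F.pullback ρ).GNS →L[ℂ] (F.pullback ρ).GNS) where
  toLinearMap := F.gnsCompress ρ Φ
  map_cstarMatrix_nonneg' k M hM := by
    refine CStarMatrix.nonneg_of_sum_inner_nonneg ?_ fun x => ?_
    · refine CStarMatrix.ext fun i j => ?_
      rw [CStarMatrix.star_apply, CStarMatrix.map_apply, CStarMatrix.map_apply,
        ← gnsCompress_star F ρ Φ hstar,
        CStarMatrix.star_apply_of_isSelfAdjoint (IsSelfAdjoint.of_nonneg hM)]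
    -- By density and continuity, the form need only be tested on tuples of classes of elements of
    -- `A`.
    · have hd : DenseRange fun b : Fin k → A => fun i =>
          ((F.pullback ρ).toPreGNS (b i) : (F.pullback ρ).GNS) :=
        DenseRange.piMap fun _ => Completion.denseRange_coe.comp
          (F.pullback ρ).toPreGNS.surjective.denseRange (Completion.continuous_coe _)
      refine hd.induction_on x ?_ fun b => ?_
      · refine isClosed_le continuous_const ?_
        fun_prop
      · have := hpos k M hM b
        simp only [map_sum, ← inner_gnsCompress] at this
        exact this

end PositiveLinearMap

end GNS

/-! ### The unique extension property, tested by a functional. -/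

section Main
variable {A : Type u} [CStarAlgebra A] [PartialOrder A] [StarOrderedRing A]
open scoped ComplexOrder InnerProductSpace

/-- Every representation on a separable space has the unique extension property relative to
`η` on `S`. -/
def UniqueExtensionWrt (S : Submodule ℂ A) (η : A →CP A) : Prop :=
  ∀ (H : Type u) [NormedAddCommGroup H] [InnerProductSpace ℂ H] [CompleteSpace H]
    [SeparableSpace H] (π : A →⋆ₙₐ[ℂ] (H →L[ℂ] H)), IsNondegenerateRep π →
    IsUniqueCPExtensionOfRestriction S (fun a => π (η a))

omit [PartialOrder A] [StarOrderedRing A] in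
theorem isNondegenerateRep_of_map_one {H : Type u} [NormedAddCommGroup H] [InnerProductSpace ℂ H]
    [CompleteSpace H] {π : A →⋆ₙₐ[ℂ] (H →L[ℂ] H)} (h : π 1 = 1) : IsNondegenerateRep π := by
  have : {x : H | ∃ (a : A) (h : H), π a h = x} = Set.univ :=
    Set.eq_univ_of_forall fun x => ⟨1, x, by rw [h]; rfl⟩
  rw [IsNondegenerateRep, this, Submodule.span_univ]
  exact top_unique (Submodule.le_topologicalClosure _)

omit [PartialOrder A] [StarOrderedRing A] in
theorem IsNondegenerateRep.map_one {H : Type u} [NormedAddCommGroup H] [InnerProductSpace ℂ H]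
    [CompleteSpace H] {π : A →⋆ₙₐ[ℂ] (H →L[ℂ] H)} (h : IsNondegenerateRep π) : π 1 = 1 := by
  refine ContinuousLinearMap.ext_on
    (s := {x : H | ∃ (a : A) (h : H), π a h = x}) ?_ ?_
  · rw [dense_iff_closure_eq, ← Submodule.topologicalClosure_coe, h, Submodule.top_coe]
  · rintro _ ⟨a, x, rfl⟩
    rw [← mul_apply_eq_comp, ← map_mul, one_mul]; rfl

/-- The compression of `Φ` lives on the GNS space of `F ∘ ρ`, which is separable whatever the size
of `D`, so `h` applies. The coefficient at the class of `1` is the claim; the factors `ρ 1` stay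
because `ρ` need not be unital. -/
theorem UniqueExtensionWrt.functional_eq [SeparableSpace A] {S : Submodule ℂ A} {η : A →CP A}
    (h : UniqueExtensionWrt S η) {D : Type u} [CStarAlgebra D] [PartialOrder D] [StarOrderedRing D]
    (F : D →ₚ[ℂ] ℂ) (ρ : A →⋆ₙₐ[ℂ] D) (Φ : A →ₗ[ℂ] D)
    (hstar : ∀ a, Φ (star a) = star (Φ a))
    (hpos : ∀ (k : ℕ) (M : CStarMatrix (Fin k) (Fin k) A), 0 ≤ M → ∀ b : Fin k → A,
      0 ≤ F (∑ i, ∑ j, star (ρ (b i)) * Φ (M i j) * ρ (b j)))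
    (hΦ : ∀ s ∈ S, ∀ b c, F (star (ρ b) * Φ s * ρ c) = F (star (ρ b) * ρ (η s) * ρ c)) (a : A) :
    F (ρ 1 * Φ a * ρ 1) = F (ρ (η a)) := by
  set g := F.pullback ρ with hg
  have hind : ∀ x b c : A, ⟪(g.toPreGNS b : g.GNS),
      g.gnsStarAlgHom x (g.toPreGNS c : g.GNS)⟫_ℂ = F (star (ρ b) * ρ x * ρ c) := by
    intro x b c
    rw [PositiveLinearMap.inner_gnsStarAlgHom, hg, PositiveLinearMap.pullback_apply, map_mul ρ, map_mul ρ,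
      map_star ρ, mul_assoc]
  have key := (h g.GNS g.gnsNonUnitalStarAlgHom
    (isNondegenerateRep_of_map_one g.gnsStarAlgHom.map_one')).2
    (F.gnsCompressCP ρ Φ hstar hpos) (fun s hs => ?_) a
  · have h1 := hind (η a) 1 1
    have h2 := F.inner_gnsCompress ρ Φ a 1 1
    have h3 : F.gnsCompress ρ Φ a = g.gnsStarAlgHom (η a) := key
    rw [h3, h1, ← map_star, star_one, ← map_mul, ← map_mul, one_mul, mul_one] at h2
    exact h2.symm
  · refine PositiveLinearMap.gns_ext fun b c => ?_
    exact (F.inner_gnsCompress ρ Φ s b c).trans ((hΦ s hs b c).trans (hind (η s) b c).symm)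
end Main

/-! ### Norm estimates for positive maps and elements. -/

section Bounds

open scoped ComplexOrder

variable {D E : Type*} [CStarAlgebra D] [PartialOrder D] [StarOrderedRing D]
  [CStarAlgebra E] [PartialOrder E] [StarOrderedRing E]

theorem PositiveLinearMap.norm_apply_le_four_mul (f : D →ₚ[ℂ] E) (x : D) :
    ‖f x‖ ≤ 4 * ‖f 1‖ * ‖x‖ := by
  obtain ⟨y, hy0, hyx, hx⟩ := CStarAlgebra.exists_sum_four_nonneg x
  conv_lhs => rw [hx]
  simp only [map_sum, map_smul]
  calc _ ≤ ∑ i : Fin 4, ‖(Complex.I ^ (i : ℕ)) • f (y i)‖ := norm_sum_le _ _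
    _ ≤ ∑ _i : Fin 4, ‖f 1‖ * ‖x‖ := by
        refine Finset.sum_le_sum fun i _ => ?_
        rw [norm_smul, norm_pow, Complex.norm_I, one_pow, one_mul]
        exact (f.norm_apply_le_of_nonneg _ (hy0 i)).trans (by gcongr; exact hyx i)
    _ = _ := by simp [mul_assoc]

/-- A Cauchy-Schwarz inequality: a small diagonal corner of a positive element makes the
off-diagonal part small. -/
theorem CStarAlgebra.norm_mul_sq_le {x q : D} (hx : 0 ≤ x) (hq : IsSelfAdjoint q) :
    ‖x * q‖ ^ 2 ≤ ‖x‖ * ‖q * x * q‖ := by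
  obtain ⟨y, rfl⟩ := CStarAlgebra.exists_eq_star_mul_self_of_nonneg hx
  have h1 : q * (star y * y) * q = star (y * q) * (y * q) := by
    rw [star_mul, hq.star_eq]; simp only [mul_assoc]
  rw [h1, CStarRing.norm_star_mul_self, CStarRing.norm_star_mul_self, mul_assoc]
  calc ‖star y * (y * q)‖ ^ 2 ≤ (‖star y‖ * ‖y * q‖) ^ 2 := by gcongr; exact norm_mul_le _ _
    _ = _ := by rw [norm_star]; ring

/-- A self-adjoint element is almost normed by a positive functional of norm at most one. -/
theorem exists_positiveLinearMap_half_le {d : D} (hd : IsSelfAdjoint d) {ε : ℝ} (hε : 0 < ε)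
    (hεd : ε ≤ ‖d‖) : ∃ f : D →ₚ[ℂ] ℂ, ‖f 1‖ ≤ 1 ∧ ε / 2 ≤ ‖f d‖ := by
  -- This form is invariant under scaling of `f`; dividing by `f 1`, nonzero since otherwise `f =
  -- 0`, normalises it.
  suffices H : ∃ f : D →ₚ[ℂ] ℂ, (f 1).re * (ε / 2) < |(f d).re| by
    obtain ⟨f, hf⟩ := H
    have h0 : 0 ≤ f 1 := f.map_nonneg zero_le_one
    have hm : ‖f 1‖ = (f 1).re := (Complex.re_eq_norm.2 h0).symm
    have hm0 : (f 1).re ≠ 0 := fun h => by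
      have h1 := f.norm_apply_le_four_mul d
      rw [hm, h] at h1
      have h2 := (Complex.abs_re_le_norm (f d)).trans h1
      rw [h] at hf
      linarith
    have hmpos : 0 < (f 1).re := lt_of_le_of_ne (hm ▸ norm_nonneg _) hm0.symm
    have hc : (0 : ℂ) ≤ (((f 1).re⁻¹ : ℝ) : ℂ) := Complex.zero_le_real.2 (inv_nonneg.2 hmpos.le)
    refine ⟨PositiveLinearMap.mk₀ ((((f 1).re⁻¹ : ℝ) : ℂ) • f.toLinearMap) fun x hx =>
      mul_nonneg hc (f.map_nonneg hx), ?_, ?_⟩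
    · change ‖(((f 1).re⁻¹ : ℝ) : ℂ) * f 1‖ ≤ 1
      rw [norm_mul, hm, Complex.norm_real, Real.norm_of_nonneg (inv_nonneg.2 hmpos.le),
        inv_mul_cancel₀ hm0]
    · change _ ≤ ‖(((f 1).re⁻¹ : ℝ) : ℂ) * f d‖
      rw [norm_mul, Complex.norm_real, Real.norm_of_nonneg (inv_nonneg.2 hmpos.le),
        le_inv_mul_iff₀ hmpos]
      exact hf.le.trans (Complex.abs_re_le_norm _)
  have hre : ∀ (f : D →ₚ[ℂ] ℂ), (f (algebraMap ℝ D (ε / 2))).re = (f 1).re * (ε / 2) := fun f => by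
    rw [Algebra.algebraMap_eq_smul_one, ← Complex.coe_smul, map_smul, smul_eq_mul,
      Complex.re_ofReal_mul, mul_comm]
  have hsa : IsSelfAdjoint (algebraMap ℝ D (ε / 2)) := .algebraMap _ (.all _)
  by_cases h1 : 0 ≤ algebraMap ℝ D (ε / 2) - d
  · by_cases h2 : 0 ≤ algebraMap ℝ D (ε / 2) + d
    · exfalso
      have h3 : ‖d‖ ≤ ε / 2 := by
        -- The product of the commuting positive elements `ε/2 - d` and `ε/2 + d` is `ε²/4 - d²`, so
        -- `‖d‖ ≤ ε/2`, against `ε ≤ ‖d‖`.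
        have hcomm : Commute (algebraMap ℝ D (ε / 2) - d) (algebraMap ℝ D (ε / 2) + d) := by
          have : Commute (algebraMap ℝ D (ε / 2)) d := Algebra.commutes _ d
          exact ((Commute.refl _).sub_left this.symm).add_right (this.sub_left (Commute.refl _))
        have h4 := hcomm.mul_nonneg h1 h2
        have h5 : (algebraMap ℝ D (ε / 2) - d) * (algebraMap ℝ D (ε / 2) + d)
            = algebraMap ℝ D ((ε / 2) ^ 2) - star d * d := by
          rw [hd.star_eq, sub_mul, mul_add, mul_add, ← Algebra.commutes (ε / 2) d, sq, map_mul]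
          abel
        rw [h5, sub_nonneg, ← CStarAlgebra.norm_le_iff_le_algebraMap _ (by positivity)
          (star_mul_self_nonneg d), CStarRing.norm_star_mul_self, ← sq] at h4
        exact le_of_sq_le_sq h4 (by positivity)
      linarith
    · obtain ⟨f, hf⟩ := exists_positiveLinearMap_re_neg (hsa.add hd) h2
      refine ⟨f, ?_⟩
      rw [map_add, Complex.add_re, hre] at hf
      exact (by linarith : _ < -(f d).re).trans_le (neg_le_abs _)
  · obtain ⟨f, hf⟩ := exists_positiveLinearMap_re_neg (hsa.sub hd) h1
    refine ⟨f, ?_⟩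
    rw [map_sub, Complex.sub_re, hre] at hf
    exact (by linarith : _ < (f d).re).trans_le (le_abs_self _)

end Bounds

/-! ### Ultrafilter limits of functionals. -/

section UltraLimit

open scoped ComplexOrder BoundedContinuousFunction

variable {D : Type*} [CStarAlgebra D] [PartialOrder D] [StarOrderedRing D]

/-- The limit along an ultrafilter of a bounded sequence of positive functionals. -/
theorem exists_ultralimit_functional [PartialOrder (ℕ →ᵇ D)] [StarOrderedRing (ℕ →ᵇ D)]
    (U : Ultrafilter ℕ) (f : ℕ → D →ₚ[ℂ] ℂ) (hf : ∀ n, ‖f n 1‖ ≤ 1) :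
    ∃ F : (ℕ →ᵇ D) →ₚ[ℂ] ℂ, ∀ x : ℕ →ᵇ D, Tendsto (fun n => f n (x n)) U (𝓝 (F x)) := by
  have hex : ∀ x : ℕ →ᵇ D, ∃ z : ℂ, Tendsto (fun n => f n (x n)) U (𝓝 z) := fun x => by
    obtain ⟨z, -, hz⟩ := (isCompact_closedBall (0 : ℂ) (4 * ‖x‖)).ultrafilter_le_nhds
      (U.map fun n => f n (x n)) (by
        refine le_principal_iff.2 (Ultrafilter.mem_map.2 (Filter.Eventually.of_forall fun n => ?_))
        change f n (x n) ∈ Metric.closedBall 0 _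
        rw [mem_closedBall_zero_iff]
        refine ((f n).norm_apply_le_four_mul (x n)).trans ?_
        have := hf n
        have := x.norm_coe_le_norm n
        calc 4 * ‖f n 1‖ * ‖x n‖ ≤ 4 * 1 * ‖x‖ := by gcongr
          _ = _ := by ring)
    exact ⟨z, hz⟩
  choose F hF using hex
  refine ⟨PositiveLinearMap.mk₀
    { toFun := F
      map_add' := fun x y => tendsto_nhds_unique (hF (x + y)) (by
        simpa using (hF x).add (hF y))
      map_smul' := fun z x => tendsto_nhds_unique (hF (z • x)) (by
        simpa using (hF x).const_mul z) } fun x hx => ?_, hF⟩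
  obtain ⟨y, rfl⟩ := CStarAlgebra.exists_eq_star_mul_self_of_nonneg hx
  refine ge_of_tendsto' (hF _) fun n => ?_
  exact (f n).map_nonneg (star_mul_self_nonneg (y n))

end UltraLimit

/-! ### From unique extension to norm convergence. -/

section Convergence

open scoped ComplexOrder BoundedContinuousFunction

variable {A : Type u} [CStarAlgebra A] [PartialOrder A] [StarOrderedRing A]
variable {D : Type u} [CStarAlgebra D] [PartialOrder D] [StarOrderedRing D]

theorem CompletelyPositiveMap.norm_apply_le (Φ : A →CP D) (a : A) : ‖Φ a‖ ≤ 4 * ‖Φ 1‖ * ‖a‖ :=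
  (PositiveLinearMap.ofClass Φ).norm_apply_le_four_mul a

theorem CompletelyPositiveMap.map_star (Φ : A →CP D) (a : A) : Φ (star a) = star (Φ a) :=
  StarHomClass.map_star (PositiveLinearMap.ofClass Φ) a

/-- The linear map into bounded sequences given by a bounded sequence of linear maps. -/
noncomputable def boundedSeqMap (Φ : ℕ → A →CP D) (C : ℝ) (hC : ∀ n, ‖Φ n 1‖ ≤ C) :
    A →ₗ[ℂ] (ℕ →ᵇ D) where
  toFun a := BoundedContinuousFunction.ofNormedAddCommGroupDiscrete (fun n => Φ n a)
    (4 * C * ‖a‖) fun n => ((Φ n).norm_apply_le a).trans (by gcongr; exact hC n)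
  map_add' a b := by ext; simp
  map_smul' z a := by ext; simp

/-- The constant-sequence embedding composed with a ⋆-homomorphism. -/
noncomputable def constSeqMap (ρ : A →⋆ₙₐ[ℂ] D) : A →⋆ₙₐ[ℂ] (ℕ →ᵇ D) where
  toFun a := BoundedContinuousFunction.const ℕ (ρ a)
  map_smul' z a := by ext; simp
  map_zero' := by ext; simp
  map_add' a b := by ext; simp
  map_mul' a b := by ext; simp
  map_star' a := by ext; simp [StarHomClass.map_star ρ]

/-- The contradiction argument with an ultralimit functional. Self-adjointness of `a` is what lets
positive functionals detect the norm of the difference `d n`. -/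
theorem UniqueExtensionWrt.tendsto_compression [SeparableSpace A] {S : Submodule ℂ A} {η : A →CP A}
    (h : UniqueExtensionWrt S η) (ρ : A →⋆ₙₐ[ℂ] D) (Φ : ℕ → A →CP D) {C : ℝ}
    (hC : ∀ n, ‖Φ n 1‖ ≤ C) (hlim : ∀ s ∈ S, Tendsto (fun n => Φ n s) atTop (𝓝 (ρ (η s))))
    {a : A} (ha : IsSelfAdjoint a) :
    Tendsto (fun n => ρ 1 * Φ n a * ρ 1) atTop (𝓝 (ρ (η a))) := by
  have hρ1 : star (ρ 1) = ρ 1 := by rw [← map_star ρ, star_one]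
  set d : ℕ → D := fun n => ρ 1 * Φ n a * ρ 1 - ρ (η a) with hd
  have hdsa : ∀ n, IsSelfAdjoint (d n) := fun n => by
    simp only [hd, IsSelfAdjoint, star_sub, star_mul, hρ1, ← map_star ρ,
      ← CompletelyPositiveMap.map_star, ha.star_eq, mul_assoc]
  rw [← tendsto_sub_nhds_zero_iff, NormedAddGroup.tendsto_nhds_zero]
  by_contra hcon
  push Not at hcon
  obtain ⟨ε, hε, hfreq⟩ := hcon
  have hf : ∀ n, ∃ f : D →ₚ[ℂ] ℂ, ‖f 1‖ ≤ 1 ∧ (ε ≤ ‖d n‖ → ε / 2 ≤ ‖f (d n)‖) := fun n => by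
    by_cases hn : ε ≤ ‖d n‖
    · obtain ⟨f, hf1, hf2⟩ := exists_positiveLinearMap_half_le (hdsa n) hε hn
      exact ⟨f, hf1, fun _ => hf2⟩
    · exact ⟨0, by simp, fun h => absurd h hn⟩
  choose f hf1 hfd using hf
  have hne : (atTop ⊓ 𝓟 {n | ε ≤ ‖d n‖}).NeBot := Filter.frequently_mem_iff_neBot.1 hfreq
  -- `U` lies below `atTop`, so limits are kept, and it contains the set of bad indices, so the
  -- lower bound `ε / 2` survives in the limit.
  set U : Ultrafilter ℕ := Ultrafilter.of (atTop ⊓ 𝓟 {n | ε ≤ ‖d n‖}) with hU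
  have hUle : (U : Filter ℕ) ≤ atTop ⊓ 𝓟 {n | ε ≤ ‖d n‖} := Ultrafilter.of_le _
  let : PartialOrder (ℕ →ᵇ D) := CStarAlgebra.spectralOrder _
  have : StarOrderedRing (ℕ →ᵇ D) := CStarAlgebra.spectralOrderedRing _
  obtain ⟨F, hF⟩ := exists_ultralimit_functional U f hf1
  have key := h.functional_eq F (constSeqMap ρ) (boundedSeqMap Φ C hC) (fun x => ?_)
    (fun k M hM b => ?_) (fun s hs b c => ?_) a
  · have h1 := (hF (constSeqMap ρ 1 * boundedSeqMap Φ C hC a * constSeqMap ρ 1)).sub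
      (hF (constSeqMap ρ (η a)))
    rw [key, sub_self] at h1
    have h2 : ∀ᶠ n in (U : Filter ℕ), ε / 2 ≤ ‖f n (d n)‖ := by
      filter_upwards [le_principal_iff.1 (hUle.trans inf_le_right)] with n hn using hfd n hn
    have h3 := (NormedAddGroup.tendsto_nhds_zero.1 h1) (ε / 2) (by positivity)
    obtain ⟨n, hn2, hn3⟩ := (h2.and h3).exists
    rw [← map_sub] at hn3
    exact absurd hn3 (not_lt.2 hn2)
  · ext n
    exact (Φ n).map_star x
  · refine ge_of_tendsto' (hF _) fun n => ?_
    have := (f n).map_nonneg (CStarMatrix.sum_star_mul_mul_nonneg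
      ((Φ n).map_cstarMatrix_nonneg M hM) fun i => ρ (b i))
    convert this
    simp [boundedSeqMap, constSeqMap]
  · refine tendsto_nhds_unique (hF _) ?_
    have h1 := hF (star (constSeqMap ρ b) * constSeqMap ρ (η s) * constSeqMap ρ c)
    have h2 : Tendsto (fun n => star (ρ b) * Φ n s * ρ c - star (ρ b) * ρ (η s) * ρ c)
        (U : Filter ℕ) (𝓝 0) := by
      rw [tendsto_sub_nhds_zero_iff]
      exact (((hlim s hs).mono_left (hUle.trans inf_le_left)).const_mul _).mul_const _
    have h3 : Tendsto (fun n => f n (star (ρ b) * Φ n s * ρ c - star (ρ b) * ρ (η s) * ρ c))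
        (U : Filter ℕ) (𝓝 0) := by
      refine squeeze_zero_norm (fun n => ?_) (by simpa using h2.norm.const_mul 4)
      refine ((f n).norm_apply_le_four_mul _).trans ?_
      have := hf1 n
      calc _ ≤ 4 * 1 * ‖star (ρ b) * Φ n s * ρ c - star (ρ b) * ρ (η s) * ρ c‖ := by gcongr
        _ = _ := by ring
    have h4 := h3.add h1
    rw [zero_add] at h4
    refine h4.congr fun n => ?_
    rw [map_sub]
    exact sub_add_cancel _ _

theorem UniqueExtensionWrt.tendsto [SeparableSpace A] {S : Submodule ℂ A} {η : A →CP A}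
    (h : UniqueExtensionWrt S η) (h1 : (1 : A) ∈ S) (hη : η 1 = 1)
    (ρ : A →⋆ₙₐ[ℂ] D) (Φ : ℕ → A →CP D)
    (hlim : ∀ s ∈ S, Tendsto (fun n => Φ n s) atTop (𝓝 (ρ (η s)))) (a : A) :
    Tendsto (fun n => Φ n a) atTop (𝓝 (ρ (η a))) := by
  have hlim1 := hlim 1 h1
  rw [hη] at hlim1
  obtain ⟨C, hC'⟩ := hlim1.norm.bddAbove_range
  have hC : ∀ n, ‖Φ n 1‖ ≤ C := fun n => hC' ⟨n, rfl⟩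
  have hρ1 : star (ρ 1) = ρ 1 := by rw [← map_star ρ, star_one]
  have hρρ : ρ 1 * ρ 1 = ρ 1 := by rw [← map_mul, one_mul]
  set p := ρ 1 with hp
  have hq : IsSelfAdjoint (1 - p) := by rw [IsSelfAdjoint, star_sub, star_one, hρ1]
  have hpos : ∀ a : A, 0 ≤ a → Tendsto (fun n => Φ n a) atTop (𝓝 (ρ (η a))) := by
    intro a ha
    have hx : ∀ n, 0 ≤ Φ n a := fun n => map_nonneg (PositiveLinearMap.ofClass (Φ n)) ha
    have hq1 : Tendsto (fun n => (1 - p) * Φ n 1 * (1 - p)) atTop (𝓝 0) := by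
      have : (1 - p) * p * (1 - p) = 0 := by rw [sub_mul, one_mul, hρρ, sub_self, zero_mul]
      simpa only [this] using (hlim1.const_mul (1 - p)).mul_const (1 - p)
    -- Since `a ≤ ‖a‖ • 1`, the corner of `Φ n a` at `1 - p` is dominated by that of `Φ n 1`, which
    -- tends to `(1 - p) * p * (1 - p) = 0`.
    have hqa : ∀ n, ‖(1 - p) * Φ n a * (1 - p)‖ ≤ ‖a‖ * ‖(1 - p) * Φ n 1 * (1 - p)‖ := fun n => by
      have h2 : Φ n a ≤ (‖a‖ : ℂ) • Φ n 1 := by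
        rw [← map_smul, Complex.coe_smul, ← Algebra.algebraMap_eq_smul_one]
        exact OrderHomClass.mono (PositiveLinearMap.ofClass (Φ n))
          (IsSelfAdjoint.le_algebraMap_norm_self (.of_nonneg ha))
      have h3 := star_left_conjugate_le_conjugate h2 (1 - p)
      rw [hq.star_eq] at h3
      have h4 := CStarAlgebra.norm_le_norm_of_nonneg_of_le
        (by have := star_left_conjugate_nonneg (hx n) (1 - p); rwa [hq.star_eq] at this) h3
      rwa [mul_smul_comm, smul_mul_assoc, norm_smul, Complex.norm_real, norm_norm] at h4
    have hxq : Tendsto (fun n => Φ n a * (1 - p)) atTop (𝓝 0) := by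
      have h5 : Tendsto (fun n => ‖Φ n a * (1 - p)‖ ^ 2) atTop (𝓝 0) := by
        refine squeeze_zero (fun n => sq_nonneg _) (fun n => ?_)
          (g := fun n => (4 * C * ‖a‖) * (‖a‖ * ‖(1 - p) * Φ n 1 * (1 - p)‖))
          (by simpa using (hq1.norm.const_mul ‖a‖).const_mul (4 * C * ‖a‖))
        refine (CStarAlgebra.norm_mul_sq_le (hx n) hq).trans ?_
        have h6 : ‖Φ n a‖ ≤ 4 * C * ‖a‖ :=
          ((Φ n).norm_apply_le a).trans (by gcongr; exact hC n)
        exact mul_le_mul h6 (hqa n) (norm_nonneg _) ((norm_nonneg _).trans h6)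
      rw [tendsto_zero_iff_norm_tendsto_zero]
      have h7 := h5.sqrt
      simpa [Real.sqrt_sq] using h7
    have hqx : Tendsto (fun n => (1 - p) * Φ n a) atTop (𝓝 0) := by
      have h8 := hxq.star
      rw [star_zero] at h8
      refine h8.congr fun n => ?_
      rw [star_mul, hq.star_eq, (IsSelfAdjoint.of_nonneg (hx n)).star_eq]
    -- With `q = 1 - p`, any `x` equals `p x p + x q + q x p`.
    have h9 := (h.tendsto_compression ρ Φ hC hlim (IsSelfAdjoint.of_nonneg ha)).add
      (hxq.add (hqx.mul_const p))
    rw [zero_mul, add_zero, add_zero] at h9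
    refine h9.congr fun n => ?_
    noncomm_ring
  obtain ⟨y, hy0, -, hy⟩ := CStarAlgebra.exists_sum_four_nonneg a
  rw [hy]
  simp only [map_sum, map_smul]
  exact tendsto_finsetSum _ fun i _ => (hpos _ (hy0 i)).const_smul _

end Convergence

/-! ### Stinespring dilation from an operator-valued kernel. -/

section Stinespring

open scoped ComplexOrder InnerProductSpace
open UniformSpace

/-- The matrix is `R⋆ R`, where `R` has the tuple `a` as one row and zeros elsewhere; an empty index
type offers no row and is treated apart. -/
theorem CStarMatrix.gram_nonneg {A : Type*} [CStarAlgebra A] [PartialOrder A] [StarOrderedRing A]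
    {n : Type*} [Fintype n] (a : n → A) :
    0 ≤ (CStarMatrix.ofMatrix (Matrix.of fun i j => star (a i) * a j) : CStarMatrix n n A) := by
  classical
  cases isEmpty_or_nonempty n with
  | inl h => exact le_of_eq (CStarMatrix.ext fun i => h.elim i)
  | inr h =>
    obtain ⟨i₀⟩ := h
    let R : CStarMatrix n n A :=
      CStarMatrix.ofMatrix (Matrix.of fun k j => if k = i₀ then a j else 0)
    have : (CStarMatrix.ofMatrix (Matrix.of fun i j => star (a i) * a j) : CStarMatrix n n A)
        = star R * R := by
      refine CStarMatrix.ext fun i j => ?_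
      rw [CStarMatrix.mul_apply, Finset.sum_eq_single i₀]
      · simp [R, CStarMatrix.star_apply]
      · intro k _ hk
        simp [R, CStarMatrix.star_apply, hk]
      · simp
    rw [this]
    exact star_mul_self_nonneg R

namespace CompletelyPositiveMap

variable {A H : Type u} [CStarAlgebra A] [PartialOrder A] [StarOrderedRing A]
  [NormedAddCommGroup H] [InnerProductSpace ℂ H] [CompleteSpace H]

/-- The operator-valued kernel `(a, b) ↦ φ (a⋆ b)` on `A`. -/
noncomputable def stinespringKernel (φ : A →CP (H →L[ℂ] H)) : Matrix A A (H →L[ℂ] H) :=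
  Matrix.of fun a b => φ (star a * b)

instance posSemidef_stinespringKernel (φ : A →CP (H →L[ℂ] H)) :
    Fact φ.stinespringKernel.PosSemidef := by
  have htfae := (RKHS.posSemidef_tfae (K := φ.stinespringKernel)).out 0 2
  refine ⟨htfae.2 ⟨?_, fun v => ?_⟩⟩
  · ext a b : 2
    simp [stinespringKernel, ← φ.map_star]
  · have h := CStarMatrix.sum_inner_nonneg (φ.map_cstarMatrix_nonneg _
      (CStarMatrix.gram_nonneg fun a : v.support => (a : A))) fun a => v a
    have h' := (Complex.le_def.1 h).1
    rw [Complex.zero_re, Finset.sum_comm] at h'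
    refine h'.trans_eq ?_
    simp only [Finsupp.sum]
    rw [← Finset.sum_coe_sort v.support, Complex.re_sum, map_sum]
    refine Finset.sum_congr rfl fun a _ => ?_
    rw [← Finset.sum_coe_sort v.support, Complex.re_sum, map_sum]
    refine Finset.sum_congr rfl fun b _ => ?_
    exact inner_re_symm (𝕜 := ℂ) _ _

variable (φ : A →CP (H →L[ℂ] H))

/-- The algebraic Stinespring space. -/
abbrev PreStinespring := RKHS.H₀ φ.stinespringKernel

/-- The Stinespring dilation space of a completely positive map. -/
abbrev Stinespring := Completion φ.PreStinespring

theorem preStinespring_inner (f g : φ.PreStinespring) :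
    ⟪f, g⟫_ℂ = Finsupp.sum f fun p z => Finsupp.sum g fun q w =>
      star z * w * ⟪φ (star q.1 * p.1) p.2, q.2⟫_ℂ := rfl

/-- The elementary tensor `a ⊗ v`. -/
noncomputable def stinespringTensor (a : A) (v : H) : φ.Stinespring :=
  ((Finsupp.single (a, v) 1 : φ.PreStinespring) : φ.Stinespring)

theorem inner_stinespringTensor (a b : A) (v w : H) :
    ⟪φ.stinespringTensor a v, φ.stinespringTensor b w⟫_ℂ = ⟪φ (star b * a) v, w⟫_ℂ := by
  refine (Completion.inner_coe (E := φ.PreStinespring) (Finsupp.single (a, v) 1)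
    (Finsupp.single (b, w) 1)).trans ?_
  rw [preStinespring_inner]
  simp

theorem stinespring_coe_eq (f : φ.PreStinespring) :
    (f : φ.Stinespring) = Finsupp.sum f fun p z => z • φ.stinespringTensor p.1 p.2 := by
  have h : (Completion.toComplₗᵢ (𝕜 := ℂ) (E := φ.PreStinespring)).toLinearMap
      = Finsupp.linearCombination ℂ fun p : A × H => φ.stinespringTensor p.1 p.2 := by
    refine Finsupp.lhom_ext' fun p => LinearMap.ext_ring ?_
    simp only [LinearMap.comp_apply, Finsupp.lsingle_apply, Finsupp.linearCombination_single,
      one_smul]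
    rfl
  exact LinearMap.congr_fun h f

theorem stinespring_vec_ext {x y : φ.Stinespring}
    (h : ∀ b w, ⟪φ.stinespringTensor b w, x⟫_ℂ = ⟪φ.stinespringTensor b w, y⟫_ℂ) : x = y := by
  refine Completion.denseRange_coe.eq_of_inner_right ℂ fun f => ?_
  rw [stinespring_coe_eq]
  simp only [Finsupp.sum, sum_inner, inner_smul_left, h]

theorem stinespring_map_ext {E : Type*} [NormedAddCommGroup E] [InnerProductSpace ℂ E]
    {T T' : φ.Stinespring →L[ℂ] E}
    (h : ∀ b w, T (φ.stinespringTensor b w) = T' (φ.stinespringTensor b w)) : T = T' := by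
  ext x
  induction x using Completion.induction_on with
  | hp => apply isClosed_eq <;> fun_prop
  | ih f =>
    rw [stinespring_coe_eq]
    simp only [Finsupp.sum, map_sum, map_smul, h]

/-- The algebraic space is free on `A × H`, so bilinearity of the tensor holds only after
completion, where null vectors vanish. -/
theorem stinespringTensor_add_left (a b : A) (v : H) :
    φ.stinespringTensor (a + b) v = φ.stinespringTensor a v + φ.stinespringTensor b v :=
  φ.stinespring_vec_ext fun c w => by
    simp [inner_add_right, inner_stinespringTensor, add_mul]

theorem stinespringTensor_smul_left (z : ℂ) (a : A) (v : H) :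
    φ.stinespringTensor (z • a) v = z • φ.stinespringTensor a v :=
  φ.stinespring_vec_ext fun c w => by
    simp [inner_smul_right, inner_stinespringTensor, mul_comm]

theorem stinespringTensor_add_right (a : A) (v w : H) :
    φ.stinespringTensor a (v + w) = φ.stinespringTensor a v + φ.stinespringTensor a w :=
  φ.stinespring_vec_ext fun c x => by
    simp [inner_add_right, inner_stinespringTensor]

theorem stinespringTensor_smul_right (z : ℂ) (a : A) (v : H) :
    φ.stinespringTensor a (z • v) = z • φ.stinespringTensor a v :=
  φ.stinespring_vec_ext fun c x => by
    simp [inner_smul_right, inner_stinespringTensor]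

/-- Left multiplication on the algebraic Stinespring space. -/
noncomputable def preStinespringMul (c : A) : φ.PreStinespring →ₗ[ℂ] φ.PreStinespring :=
  Finsupp.lmapDomain ℂ ℂ fun p => (c * p.1, p.2)

theorem preStinespringMul_inner (c : A) (f g : φ.PreStinespring) :
    ⟪φ.preStinespringMul c f, φ.preStinespringMul c g⟫_ℂ
      = Finsupp.sum f fun p z => Finsupp.sum g fun q w =>
        star z * w * ⟪φ (star q.1 * (star c * c) * p.1) p.2, q.2⟫_ℂ := by
  rw [preStinespring_inner, preStinespringMul, Finsupp.lmapDomain_apply, Finsupp.lmapDomain_apply,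
    Finsupp.sum_mapDomain_index (by simp) (fun p z w => by
      simp only [star_add, add_mul, Finsupp.sum_add])]
  refine Finsupp.sum_congr fun p _ => ?_
  rw [Finsupp.sum_mapDomain_index (by simp) (fun p z w => by ring)]
  simp only [star_mul, mul_assoc]

theorem preStinespringMul_norm_le (c : A) (f : φ.PreStinespring) :
    ‖φ.preStinespringMul c f‖ ≤ ‖c‖ * ‖f‖ := by
  have hpos : 0 ≤ algebraMap ℝ A (‖c‖ ^ 2) - star c * c :=
    sub_nonneg.2 CStarAlgebra.star_mul_le_algebraMap_norm_sq
  -- With `d⋆ d = ‖c‖² - c⋆ c`, multiplication by `c` and by `d` satisfies `‖c f‖² + ‖d f‖² = ‖c‖²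
  -- ‖f‖²`.
  obtain ⟨d, hd⟩ := CStarAlgebra.exists_eq_star_mul_self_of_nonneg hpos
  have hsum : ⟪φ.preStinespringMul c f, φ.preStinespringMul c f⟫_ℂ
      + ⟪φ.preStinespringMul d f, φ.preStinespringMul d f⟫_ℂ = ((‖c‖ ^ 2 : ℝ) : ℂ) * ⟪f, f⟫_ℂ := by
    rw [preStinespringMul_inner, preStinespringMul_inner, preStinespring_inner]
    simp only [Finsupp.sum, Finset.mul_sum, ← Finset.sum_add_distrib]
    refine Finset.sum_congr rfl fun p _ => Finset.sum_congr rfl fun q _ => ?_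
    rw [← mul_add, ← inner_add_left, ← add_apply, ← map_add, ← add_mul, ← mul_add, ← hd,
      add_sub_cancel, Algebra.algebraMap_eq_smul_one, ← Complex.coe_smul, mul_smul_comm, mul_one,
      smul_mul_assoc, map_smul, smul_apply, inner_smul_left, Complex.conj_ofReal]
    ring
  have h := congrArg Complex.re hsum
  rw [Complex.add_re, Complex.re_ofReal_mul] at h
  have e : ∀ x : φ.PreStinespring, (⟪x, x⟫_ℂ).re = ‖x‖ ^ 2 := fun x =>
    inner_self_eq_norm_sq (𝕜 := ℂ) x
  rw [e, e, e] at h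
  refine le_of_sq_le_sq ?_ (by positivity)
  rw [mul_pow]
  linarith [sq_nonneg ‖φ.preStinespringMul d f‖]

/-- Left multiplication on the Stinespring space. -/
noncomputable def stinespringMul (c : A) : φ.Stinespring →L[ℂ] φ.Stinespring :=
  ((φ.preStinespringMul c).mkContinuous ‖c‖ (φ.preStinespringMul_norm_le c)).completion

@[simp]
theorem stinespringMul_tensor (c a : A) (v : H) :
    φ.stinespringMul c (φ.stinespringTensor a v) = φ.stinespringTensor (c * a) v := by
  rw [stinespringMul, stinespringTensor, ContinuousLinearMap.completion_apply_coe,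
    LinearMap.mkContinuous_apply, preStinespringMul, Finsupp.lmapDomain_apply,
    Finsupp.mapDomain_single]
  rfl

theorem stinespringMul_mul (c d : A) :
    φ.stinespringMul (c * d) = φ.stinespringMul c * φ.stinespringMul d :=
  φ.stinespring_map_ext fun b w => by simp [mul_assoc]

/-- The Stinespring representation of a completely positive map. -/
noncomputable def stinespringRep : A →⋆ₐ[ℂ] (φ.Stinespring →L[ℂ] φ.Stinespring) where
  toFun := φ.stinespringMul
  map_one' := φ.stinespring_map_ext fun b w => by simp
  map_mul' := φ.stinespringMul_mul
  map_zero' := φ.stinespring_map_ext fun b w => by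
    simpa using φ.stinespringTensor_smul_left 0 0 w
  map_add' c d := φ.stinespring_map_ext fun b w => by
    simp [add_mul, stinespringTensor_add_left]
  commutes' z := φ.stinespring_map_ext fun b w => by
    simp [Algebra.algebraMap_eq_smul_one, stinespringTensor_smul_left]
  map_star' c := by
    refine φ.stinespring_map_ext fun b w => φ.stinespring_vec_ext fun a v => ?_
    rw [ContinuousLinearMap.star_eq_adjoint, ContinuousLinearMap.adjoint_inner_right]
    simp [inner_stinespringTensor, mul_assoc]

/-- The Stinespring isometry of a unital completely positive map. -/
noncomputable def stinespringIsometry (h1 : φ 1 = 1) : H →ₗᵢ[ℂ] φ.Stinespring where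
  toFun v := φ.stinespringTensor 1 v
  map_add' := φ.stinespringTensor_add_right 1
  map_smul' z v := φ.stinespringTensor_smul_right z 1 v
  norm_map' v := by
    refine (sq_eq_sq₀ (norm_nonneg _) (norm_nonneg _)).1 ?_
    rw [← inner_self_eq_norm_sq (𝕜 := ℂ), ← inner_self_eq_norm_sq (𝕜 := ℂ)]
    change RCLike.re ⟪φ.stinespringTensor 1 v, φ.stinespringTensor 1 v⟫_ℂ = _
    rw [inner_stinespringTensor]
    simp [h1]

theorem stinespring_inner (h1 : φ 1 = 1) (a : A) (v w : H) :
    ⟪φ.stinespringIsometry h1 v, φ.stinespringRep a (φ.stinespringIsometry h1 w)⟫_ℂ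
      = ⟪v, φ a w⟫_ℂ := by
  change ⟪φ.stinespringTensor 1 v, φ.stinespringMul a (φ.stinespringTensor 1 w)⟫_ℂ = _
  rw [stinespringMul_tensor, inner_stinespringTensor, mul_one, mul_one, φ.map_star,
    ContinuousLinearMap.star_eq_adjoint, ContinuousLinearMap.adjoint_inner_left]

end CompletelyPositiveMap

end Stinespring

/-! ### Direct sums of representations and shift isometries. -/

section DirectSum

open scoped ComplexOrder InnerProductSpace lp ENNReal

variable {A : Type u} [CStarAlgebra A]

variable (A) in
/-- A unital representation of `A` on a Hilbert space. -/
structure HilbertRep where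
  /-- The Hilbert space. -/
  space : Type u
  [normedAddCommGroup : NormedAddCommGroup space]
  [innerProductSpace : InnerProductSpace ℂ space]
  [completeSpace : CompleteSpace space]
  /-- The representation. -/
  rep : A →⋆ₐ[ℂ] (space →L[ℂ] space)

attribute [instance] HilbertRep.normedAddCommGroup HilbertRep.innerProductSpace
  HilbertRep.completeSpace

variable {J : Type u} (R : J → HilbertRep A)

/-- The Hilbert space direct sum. -/
abbrev HilbertRep.sumSpace := lp (fun j => (R j).space) 2

theorem HilbertRep.norm_rep_apply_le (a : A) (x : HilbertRep.sumSpace R) (j : J) :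
    ‖(R j).rep a (x j)‖ ≤ ‖(((‖a‖ : ℂ) • x : HilbertRep.sumSpace R)) j‖ := by
  rw [lp.coeFn_smul, Pi.smul_apply, norm_smul, Complex.norm_real, norm_norm]
  exact ((R j).rep a).le_of_opNorm_le (NonUnitalStarAlgHom.norm_apply_le (R j).rep a) _

/-- The action of an element on the Hilbert space direct sum. -/
noncomputable def HilbertRep.sumOp (a : A) :
    HilbertRep.sumSpace R →L[ℂ] HilbertRep.sumSpace R :=
  LinearMap.mkContinuous
    { toFun := fun x => ⟨fun j => (R j).rep a (x j),
        (lp.memℓp ((‖a‖ : ℂ) • x)).mono' fun j => HilbertRep.norm_rep_apply_le R a x j⟩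
      map_add' := fun x y => lp.ext (funext fun j => map_add ((R j).rep a) (x j) (y j))
      map_smul' := fun z x => lp.ext (funext fun j => map_smul ((R j).rep a) z (x j)) }
    ‖a‖ fun x => by
      refine (lp.norm_mono (y := (‖a‖ : ℂ) • x) two_ne_zero fun j =>
        HilbertRep.norm_rep_apply_le R a x j).trans_eq ?_
      rw [norm_smul, Complex.norm_real, norm_norm]

theorem HilbertRep.sumOp_apply (a : A) (x : HilbertRep.sumSpace R) (j : J) :
    HilbertRep.sumOp R a x j = (R j).rep a (x j) := rfl

theorem HilbertRep.sumSpace_ext {x y : HilbertRep.sumSpace R} (h : ∀ j, x j = y j) : x = y :=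
  lp.ext (funext h)

/-- The direct sum of a family of representations. -/
noncomputable def HilbertRep.sum :
    A →⋆ₐ[ℂ] (HilbertRep.sumSpace R →L[ℂ] HilbertRep.sumSpace R) where
  toFun := HilbertRep.sumOp R
  map_one' := by
    ext x j; simp [HilbertRep.sumOp_apply]
  map_mul' a b := by
    ext x j; simp [HilbertRep.sumOp_apply]
  map_zero' := by
    ext x j; simp [HilbertRep.sumOp_apply]
  map_add' a b := by
    ext x j; simp [HilbertRep.sumOp_apply]
  commutes' z := by
    ext x j; simp [HilbertRep.sumOp_apply, Algebra.algebraMap_eq_smul_one]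
  map_star' a := by
    rw [ContinuousLinearMap.star_eq_adjoint, ContinuousLinearMap.eq_adjoint_iff]
    intro x y
    rw [lp.inner_eq_tsum, lp.inner_eq_tsum]
    refine tsum_congr fun j => ?_
    rw [HilbertRep.sumOp_apply, HilbertRep.sumOp_apply, map_star,
      ContinuousLinearMap.star_eq_adjoint, ContinuousLinearMap.adjoint_inner_left]

variable [DecidableEq J]

theorem HilbertRep.sumOp_single (a : A) (j : J) (v : (R j).space) :
    HilbertRep.sumOp R a (lp.single 2 j v) = lp.single 2 j ((R j).rep a v) := by
  refine HilbertRep.sumSpace_ext R fun k => ?_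
  rw [HilbertRep.sumOp_apply]
  by_cases h : k = j
  · subst h
    rw [lp.single_apply_self, lp.single_apply_self]
  · rw [lp.single_apply_ne _ _ _ h, lp.single_apply_ne _ _ _ h, map_zero]

theorem HilbertRep.sumSpace_map_ext {T T' : HilbertRep.sumSpace R →L[ℂ] HilbertRep.sumSpace R}
    (h : ∀ j k (v : (R j).space) (w : (R k).space),
      ⟪(lp.single 2 j v : HilbertRep.sumSpace R), T (lp.single 2 k w)⟫_ℂ
        = ⟪(lp.single 2 j v : HilbertRep.sumSpace R), T' (lp.single 2 k w)⟫_ℂ) : T = T' := by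
  have h2 : ∀ k (w : (R k).space), T (lp.single 2 k w) = T' (lp.single 2 k w) := fun k w => by
    refine HilbertRep.sumSpace_ext R fun j => ext_inner_left ℂ fun v => ?_
    have e : ∀ y : HilbertRep.sumSpace R, ⟪v, y j⟫_ℂ
        = ⟪(lp.single 2 j v : HilbertRep.sumSpace R), y⟫_ℂ := fun y =>
      (lp.inner_single_left (𝕜 := ℂ) (G := fun j => (R j).space) j v y).symm
    exact (e _).trans ((h j k v w).trans (e _).symm)
  ext x : 1
  have hx := lp.hasSum_single (p := 2) (by simp) x
  refine (hx.mapL T).unique ?_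
  simp only [h2]
  exact hx.mapL T'

variable {R} {e : J → J}
  (V : ∀ j, (R j).space →ₗᵢ[ℂ] (R (e j)).space)

/-- The inclusion of a summand into the direct sum. -/
noncomputable def HilbertRep.incl (j : J) : (R j).space →ₗᵢ[ℂ] HilbertRep.sumSpace R where
  toLinearMap := lp.lsingle (𝕜 := ℂ) (E := fun j => (R j).space) 2 j
  norm_map' v := lp.norm_single (E := fun j => (R j).space) (p := 2) two_pos j v

theorem HilbertRep.orthogonalFamily_incl_comp (he : Function.Injective e) :
    OrthogonalFamily ℂ (fun j => (R j).space) fun j => (HilbertRep.incl (e j)).comp (V j) := by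
  intro j k hjk v w
  change ⟪(lp.single 2 (e j) (V j v) : HilbertRep.sumSpace R), lp.single 2 (e k) (V k w)⟫_ℂ = 0
  rw [lp.inner_single_left, lp.single_apply_ne _ _ _ (he.ne hjk), inner_zero_right]

/-- The isometry shifting summands along an injective map. -/
noncomputable def HilbertRep.shift (he : Function.Injective e) : HilbertRep.sumSpace R →ₗᵢ[ℂ] HilbertRep.sumSpace R :=
  (HilbertRep.orthogonalFamily_incl_comp V he).linearIsometry

theorem HilbertRep.shift_single (he : Function.Injective e) (j : J) (v : (R j).space) :
    HilbertRep.shift V he (lp.single 2 j v) = lp.single 2 (e j) (V j v) :=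
  (HilbertRep.orthogonalFamily_incl_comp V he).linearIsometry_apply_single v

/-- Conjugating the direct sum by the shift stays block diagonal: block `j` is the compression of
block `e j` by `V j`. -/
theorem HilbertRep.inner_shift (he : Function.Injective e) (a : A) (j k : J) (v : (R j).space) (w : (R k).space) :
    ⟪HilbertRep.shift V he (lp.single 2 j v),
      HilbertRep.sum R a (HilbertRep.shift V he (lp.single 2 k w))⟫_ℂ
      = if h : k = j then ⟪V j v, (R (e j)).rep a (V j (h ▸ w))⟫_ℂ else 0 := by
  change ⟪_, HilbertRep.sumOp R a _⟫_ℂ = _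
  rw [shift_single, shift_single, sumOp_single, lp.inner_single_left]
  split_ifs with h
  · subst h
    rw [lp.single_apply_self]
  · rw [lp.single_apply_ne _ _ _ (he.ne (Ne.symm h)), inner_zero_right]

theorem HilbertRep.inner_sum (a : A) (j k : J) (v : (R j).space) (w : (R k).space) :
    ⟪(lp.single 2 j v : HilbertRep.sumSpace R), HilbertRep.sum R a (lp.single 2 k w)⟫_ℂ
      = if h : k = j then ⟪v, (R j).rep a (h ▸ w)⟫_ℂ else 0 := by
  change ⟪_, HilbertRep.sumOp R a _⟫_ℂ = _
  rw [sumOp_single, lp.inner_single_left]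
  split_ifs with h
  · subst h
    rw [lp.single_apply_self]
  · rw [lp.single_apply_ne _ _ _ (Ne.symm h), inner_zero_right]

end DirectSum

/-! ### Basic completely positive maps. -/

section CPConstructions

variable {A B C : Type*} [CStarAlgebra A] [PartialOrder A] [StarOrderedRing A]
  [CStarAlgebra B] [PartialOrder B] [StarOrderedRing B]
  [CStarAlgebra C] [PartialOrder C] [StarOrderedRing C]

/-- The composition of completely positive maps. -/
noncomputable def CompletelyPositiveMap.comp (Ψ : B →CP C) (Φ : A →CP B) : A →CP C where
  toLinearMap := Ψ.toLinearMap ∘ₗ Φ.toLinearMap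
  map_cstarMatrix_nonneg' _ M hM :=
    Ψ.map_cstarMatrix_nonneg _ (Φ.map_cstarMatrix_nonneg M hM)

/-- A ⋆-homomorphism as a completely positive map. -/
noncomputable def NonUnitalStarAlgHom.toCP (ρ : A →⋆ₙₐ[ℂ] B) : A →CP B :=
  CompletelyPositiveMapClass.toCompletelyPositiveLinearMap ρ

/-- Conjugation `x ↦ c⋆ x c` as a completely positive map. -/
def CompletelyPositiveMap.conj (c : A) : A →CP A where
  toFun x := star c * x * c
  map_add' x y := by rw [mul_add, add_mul]
  map_smul' z x := by simp
  map_cstarMatrix_nonneg' _ M hM := by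
    obtain ⟨L, rfl⟩ := CStarAlgebra.exists_eq_star_mul_self_of_nonneg hM
    have : (star L * L).map (fun x => star c * x * c)
        = star (L.map (· * c)) * L.map (· * c) := by
      refine CStarMatrix.ext fun i j => ?_
      simp only [CStarMatrix.mul_apply, CStarMatrix.map_apply, CStarMatrix.star_apply,
        Finset.mul_sum, Finset.sum_mul, star_mul, mul_assoc]
    exact this ▸ star_mul_self_nonneg (L.map (· * c))

end CPConstructions

/-! ### The dilation chain and its faithful direct sum. -/

section Dilation

open scoped ComplexOrder InnerProductSpace lp ENNReal

variable {A : Type u} [CStarAlgebra A] [PartialOrder A] [StarOrderedRing A]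

/-- A representation `π` with a unital completely positive map agreeing with `π ∘ η` on `S`. -/
structure ExtensionPair (S : Submodule ℂ A) (η : A →CP A) where
  /-- The representation. -/
  toRep : HilbertRep A
  /-- The extension. -/
  ext : A →CP (toRep.space →L[ℂ] toRep.space)
  ext_one : ext 1 = 1
  ext_eq : ∀ s ∈ S, ext s = toRep.rep (η s)

variable {S : Submodule ℂ A} {η : A →CP A}

/-- A representation `π` together with `π ∘ η`. -/
noncomputable def HilbertRep.toExtensionPair (R : HilbertRep A) (S : Submodule ℂ A)
    (hη : η 1 = 1) : ExtensionPair S η where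
  toRep := R
  ext := (NonUnitalStarAlgHom.toCP (R.rep : A →⋆ₙₐ[ℂ] _)).comp η
  ext_one := by
    change R.rep (η 1) = 1
    rw [hη, map_one]
  ext_eq _ _ := rfl

/-- The Stinespring representation of the extension. -/
noncomputable def ExtensionPair.next (hη : η 1 = 1) (P : ExtensionPair S η) : ExtensionPair S η :=
  HilbertRep.toExtensionPair ⟨P.ext.Stinespring, P.ext.stinespringRep⟩ S hη

/-- Iterated Stinespring representations. -/
noncomputable def ExtensionPair.chain (hη : η 1 = 1) (P : ExtensionPair S η) :
    ℕ → ExtensionPair S η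
  | 0 => P
  | n + 1 => (ExtensionPair.chain hη P n).next hη

variable (A) in
/-- The GNS representation of a positive functional. -/
noncomputable def HilbertRep.gns (f : A →ₚ[ℂ] ℂ) : HilbertRep A := ⟨f.GNS, f.gnsStarAlgHom⟩

theorem eq_zero_of_gns_eq_zero {a : A} (h : ∀ f : A →ₚ[ℂ] ℂ, f.gnsStarAlgHom a = 0) : a = 0 := by
  have h1 : ∀ f : A →ₚ[ℂ] ℂ, f (star a * a) = 0 := fun f => by
    have := f.inner_gnsStarAlgHom (star a * a) 1 1
    rw [map_mul, h f] at this
    simpa using this.symm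
  rw [← CStarRing.star_mul_self_eq_zero_iff]
  by_contra hne
  have h2 : ¬ 0 ≤ -(star a * a) := fun h3 =>
    hne (le_antisymm (neg_nonneg.1 h3) (star_mul_self_nonneg a))
  obtain ⟨f, hf⟩ := exists_positiveLinearMap_re_neg (IsSelfAdjoint.star_mul_self a).neg h2
  rw [map_neg, h1 f] at hf
  simp at hf

/-- An extension of `π ∘ η` from `S` is realized, inside a faithful representation `σ`, by a
unital completely positive map that agrees with `η` on `σ(S)`. -/
theorem ExtensionPair.exists_faithful (hη : η 1 = 1) (P : ExtensionPair S η) :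
    ∃ (K : Type u) (_ : NormedAddCommGroup K) (_ : InnerProductSpace ℂ K) (_ : CompleteSpace K)
      (σ : A →⋆ₐ[ℂ] (K →L[ℂ] K)) (ψ : (K →L[ℂ] K) →CP (K →L[ℂ] K)),
      Function.Injective σ ∧ ψ 1 = 1 ∧ (∀ s ∈ S, ψ (σ s) = σ (η s)) ∧
      ((∀ a, ψ (σ a) = σ (η a)) → ∀ a, P.ext a = P.toRep.rep (η a)) := by
  classical
  -- The index `none` starts the chain of `P`; the indices `some f` start GNS chains, present only
  -- to make `σ` faithful.
  let P₀ : Option (A →ₚ[ℂ] ℂ) → ExtensionPair S η := fun i =>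
    i.elim P fun f => (HilbertRep.gns A f).toExtensionPair S hη
  let Q : Option (A →ₚ[ℂ] ℂ) × ℕ → ExtensionPair S η := fun j => (P₀ j.1).chain hη j.2
  let R : Option (A →ₚ[ℂ] ℂ) × ℕ → HilbertRep A := fun j => (Q j).toRep
  let e : Option (A →ₚ[ℂ] ℂ) × ℕ → Option (A →ₚ[ℂ] ℂ) × ℕ := fun j => (j.1, j.2 + 1)
  have he : Function.Injective e := fun i j h => by
    simp only [e, Prod.mk.injEq, add_left_inj] at h
    exact Prod.ext h.1 h.2
  let V : ∀ j, (R j).space →ₗᵢ[ℂ] (R (e j)).space := fun j =>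
    (Q j).ext.stinespringIsometry (Q j).ext_one
  have hV : ∀ j a v w, ⟪V j v, (R (e j)).rep a (V j w)⟫_ℂ = ⟪v, (Q j).ext a w⟫_ℂ := fun j a v w =>
    (Q j).ext.stinespring_inner (Q j).ext_one a v w
  let W : HilbertRep.sumSpace R →L[ℂ] HilbertRep.sumSpace R :=
    (HilbertRep.shift V he).toContinuousLinearMap
  have hW : star W * W = 1 := by
    rw [ContinuousLinearMap.star_eq_adjoint]
    refine ContinuousLinearMap.ext fun x => ext_inner_left ℂ fun y => ?_
    rw [mul_apply_eq_comp, ContinuousLinearMap.adjoint_inner_right]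
    exact (HilbertRep.shift V he).inner_map_map y x
  have hWin : ∀ a j k (v : (R j).space) (w : (R k).space),
      ⟪(lp.single 2 j v : HilbertRep.sumSpace R),
        CompletelyPositiveMap.conj W (HilbertRep.sum R a) (lp.single 2 k w)⟫_ℂ
      = if h : k = j then ⟪v, (Q j).ext a (h ▸ w)⟫_ℂ else 0 := fun a j k v w => by
    change ⟪_, (star W * HilbertRep.sum R a * W) _⟫_ℂ = _
    rw [ContinuousLinearMap.star_eq_adjoint, mul_apply_eq_comp, mul_apply_eq_comp,
      ContinuousLinearMap.adjoint_inner_right]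
    refine (HilbertRep.inner_shift V he a j k v w).trans ?_
    split_ifs with h
    · exact hV _ _ _ _
    · rfl
  refine ⟨HilbertRep.sumSpace R, inferInstance, inferInstance, inferInstance, HilbertRep.sum R,
    CompletelyPositiveMap.conj W, ?_, ?_, fun s hs => ?_, fun h a => ?_⟩
  · rw [injective_iff_map_eq_zero]
    intro a ha
    refine eq_zero_of_gns_eq_zero fun f => ContinuousLinearMap.ext fun x =>
      ext_inner_left ℂ fun y => ?_
    have h0 := HilbertRep.inner_sum (R := R) a (some f, 0) (some f, 0) y x
    rw [ha, dif_pos rfl, zero_apply, inner_zero_right] at h0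
    rw [zero_apply, inner_zero_right]
    exact h0.symm
  · change star W * 1 * W = 1
    rw [mul_one, hW]
  · refine HilbertRep.sumSpace_map_ext R fun j k v w => ?_
    rw [hWin, HilbertRep.inner_sum]
    simp only [(Q j).ext_eq s hs]
    rfl
  -- The block at `(none, 0)` is `P.ext` on one side and `P.toRep.rep ∘ η` on the other.
  · refine ContinuousLinearMap.ext fun x => ext_inner_left ℂ fun y => ?_
    have h1 := hWin a (none, 0) (none, 0) y x
    have h2 := HilbertRep.inner_sum (R := R) (η a) (none, 0) (none, 0) y x
    rw [dif_pos rfl] at h1 h2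
    rw [h a] at h1
    exact h1.symm.trans h2

end Dilation

/-- The common source of unique extension from statements 1 and 4: both yield the hypothesis `H`,
the first through constant sequences. An extension is automatically unital because `1 ∈ S`, so it
starts a dilation chain. -/
theorem UniqueExtensionWrt.of_forall_faithful {A : Type u} [CStarAlgebra A] [PartialOrder A]
    [StarOrderedRing A] {S : Submodule ℂ A} (h1 : (1 : A) ∈ S) {η : A →CP A} (hη : η 1 = 1)
    (H : ∀ (K : Type u) [NormedAddCommGroup K] [InnerProductSpace ℂ K] [CompleteSpace K]
      (σ : A →⋆ₐ[ℂ] (K →L[ℂ] K)), Function.Injective σ →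
      ∀ ψ : (K →L[ℂ] K) →CP (K →L[ℂ] K), ψ 1 = 1 →
      (∀ s ∈ S, ψ (σ s) = σ (η s)) → ∀ a, ψ (σ a) = σ (η a)) :
    UniqueExtensionWrt S η := by
  intro H₀ _ _ _ _ π hπ
  have hπ1 := hπ.map_one
  refine ⟨⟨(NonUnitalStarAlgHom.toCP π).comp η, fun a => rfl⟩, fun Ψ (hΨ : ∀ s ∈ S, Ψ s = π (η s)) a => ?_⟩
  let π' : A →⋆ₐ[ℂ] (H₀ →L[ℂ] H₀) :=
    { π with
      map_one' := hπ1
      commutes' := fun z => by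
        rw [Algebra.algebraMap_eq_smul_one, Algebra.algebraMap_eq_smul_one]
        exact (map_smul π z 1).trans (by rw [hπ1]) }
  let P : ExtensionPair S η :=
    { toRep := ⟨H₀, π'⟩
      ext := Ψ
      ext_one := (hΨ 1 h1).trans (by rw [hη, hπ1])
      ext_eq := hΨ }
  obtain ⟨K, _, _, _, σ, ψ, hσ, hψ1, hψ, hP⟩ := P.exists_faithful hη
  exact hP (H K σ hσ ψ hψ1 hψ) a

theorem theorem3p3 {A : Type u} [CStarAlgebra A] [PartialOrder A] [StarOrderedRing A]
    (S : Submodule ℂ A) (hS : IsOperatorSystem S) (hsep : IsSeparable (S : Set A))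
    (hgen : GeneratesCStarAlgebra S) (η : A →CP A) (hη : η 1 = 1) :
    List.TFAE [
      IsHyperrigidWrt S η,
      ∀ (H : Type u) [NormedAddCommGroup H] [InnerProductSpace ℂ H] [CompleteSpace H]
        [SeparableSpace H] (π : A →⋆ₙₐ[ℂ] (H →L[ℂ] H)), IsNondegenerateRep π →
        ∀ φ : ℕ → (A →CP (H →L[ℂ] H)), (∀ n, φ n 1 = 1) →
          (∀ s ∈ S, Tendsto (fun n => ‖φ n s - π (η s)‖) atTop (𝓝 0)) →
          ∀ a : A, Tendsto (fun n => ‖φ n a - π (η a)‖) atTop (𝓝 0),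
      ∀ (H : Type u) [NormedAddCommGroup H] [InnerProductSpace ℂ H] [CompleteSpace H]
        [SeparableSpace H] (π : A →⋆ₙₐ[ℂ] (H →L[ℂ] H)), IsNondegenerateRep π →
        IsUniqueCPExtensionOfRestriction S (fun a => π (η a)),
      ∀ (B : Type u) [CStarAlgebra B] [PartialOrder B] [StarOrderedRing B]
        (ρ : A →⋆ₐ[ℂ] B) (φ : B →CP B), φ 1 = 1 →
        (∀ s ∈ S, φ (ρ s) = ρ (η s)) → ∀ a : A, φ (ρ a) = ρ (η a)] := by
  have hA : SeparableSpace A := separableSpace_of_generates hS hsep hgen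
  tfae_have 1 → 3 := fun h => by
    refine UniqueExtensionWrt.of_forall_faithful hS.1 hη fun K _ _ _ σ hσ ψ hψ1 hψ a => ?_
    have := h K (σ : A →⋆ₙₐ[ℂ] (K →L[ℂ] K)) hσ (fun _ => ψ) (fun _ => hψ1) (fun s hs => by
      simp [hψ s hs]) a
    rw [tendsto_const_nhds_iff] at this
    exact sub_eq_zero.1 (norm_eq_zero.1 this)
  tfae_have 4 → 3 := fun h =>
    UniqueExtensionWrt.of_forall_faithful hS.1 hη fun K _ _ _ σ _ ψ hψ1 hψ => h _ σ ψ hψ1 hψ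
  tfae_have 2 → 3 := fun h H _ _ _ _ π hπ => by
    refine ⟨⟨(NonUnitalStarAlgHom.toCP π).comp η, fun a => rfl⟩, fun Ψ (hΨ : ∀ s ∈ S, Ψ s = π (η s)) a => ?_⟩
    have := h H π hπ (fun _ => Ψ) (fun _ => (hΨ 1 hS.1).trans (by rw [hη, hπ.map_one])) (fun s hs => by
      simp [hΨ s hs]) a
    rw [tendsto_const_nhds_iff] at this
    exact sub_eq_zero.1 (norm_eq_zero.1 this)
  -- Here `σ` need not be unital nor `H` separable; `UniqueExtensionWrt.tendsto` requires neither.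
  tfae_have 3 → 1 := fun h H _ _ _ σ _ ψ _ hψ a => by
    simp only [← tendsto_iff_norm_sub_tendsto_zero] at hψ ⊢
    exact UniqueExtensionWrt.tendsto h hS.1 hη σ
      (fun n => (ψ n).comp (NonUnitalStarAlgHom.toCP σ)) hψ a
  tfae_have 3 → 2 := fun h H _ _ _ _ π _ φ _ hφ a => by
    simp only [← tendsto_iff_norm_sub_tendsto_zero] at hφ ⊢
    exact UniqueExtensionWrt.tendsto h hS.1 hη π φ hφ a
  tfae_have 3 → 4 := fun h B _ _ _ ρ φ _ hφ a => by
    have := UniqueExtensionWrt.tendsto h hS.1 hη (ρ : A →⋆ₙₐ[ℂ] B)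
      (fun _ => φ.comp (NonUnitalStarAlgHom.toCP (ρ : A →⋆ₙₐ[ℂ] B)))
      (fun s hs => tendsto_const_nhds_iff.2 (hφ s hs)) a
    exact tendsto_const_nhds_iff.1 this
  tfae_finish
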